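/- Let $d\in\mathbb N$ and let $\mu,\nu$ be Borel probability measures on $\mathbb R^d$ with finite second moments, $\int|x|^2\,d\mu<\infty$ and $\int|y|^2\,d\nu<\infty$. Suppose that $\mu$ is absolutely continuous with respect to Lebesgue measure and that $\nu$ has no atoms. Let $c_w(x,y)=-|x-y|^2$, and let $\Pi(\mu,\nu)$ be the set of transport plans, i.e. of probability measures on $\mathbb R^d\times\mathbb R^d$ with marginals $\mu$ and $\nu$. Then there is a Borel map $T:\mathbb R^d\to\mathbb R^d$ with $T_\sharp\mu=\nu$ such that: 1. $T$ is an optimal transport map, i.e. it minimizes $\int c_w(x,S(x))\,d\mu(x)$ among all Borel maps $S$ with $S_\sharp\mu=\nu$, and every optimal transport map coincides with $T$ $\mu$-almost everywhere; 2. the Kantorovich minimum is attained and equals the Monge infimum: $$\min\Big\{\int c_w\,d\gamma:\gamma\in\Pi(\mu,\nu)\Big\}=\inf\Big\{\int c_w(x,S(x))\,d\mu(x):S \text{ Borel},\ S_\sharp\mu=\nu\Big\};$$ 3. $T=\nabla\phi$ $\mu$-almost everywhere for a concave function $\phi:D\to\mathbb R$ on an open convex set $D\subseteq\mathbb R^d$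 with $\mu(D)=1$ (that is, $\phi$ is differentiable at $\mu$-almost every point of $D$, with gradient $T$); if $\nu$ is concentrated on a bounded set, one can take $D=\mathbb R^d$; 4. there is a unique optimal transport plan $\overline\gamma\in\Pi(\mu,\nu)$ (a minimizer of $\gamma\mapsto\int c_w\,d\gamma$ over $\Pi(\mu,\nu)$), and $\overline\gamma=(\mathrm{Id}\times T)_\sharp\mu$. -/

import Mathlib

open MeasureTheory

noncomputable section

/-- The repulsive harmonic cost `c_w(x, y) = -|x - y|^2` on `ℝ^d`. -/
def repulsiveCost {d : ℕ} (x y : EuclideanSpace ℝ (Fin d)) : ℝ :=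
  -‖x - y‖ ^ 2

/-- The transport plans between `μ` and `ν`: probability measures on `ℝ^d × ℝ^d` whose
marginals are `μ` and `ν`. -/
def transportPlans {d : ℕ} (μ ν : Measure (EuclideanSpace ℝ (Fin d))) :
    Set (Measure (EuclideanSpace ℝ (Fin d) × EuclideanSpace ℝ (Fin d))) :=
  {γ | IsProbabilityMeasure γ ∧ γ.map Prod.fst = μ ∧ γ.map Prod.snd = ν}

/-- The transport maps from `μ` to `ν`: Borel maps `T` with `T_# μ = ν`. -/
def transportMaps {d : ℕ} (μ ν : Measure (EuclideanSpace ℝ (Fin d))) :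
    Set (EuclideanSpace ℝ (Fin d) → EuclideanSpace ℝ (Fin d)) :=
  {T | Measurable T ∧ μ.map T = ν}

/-- The Kantorovich functional `∫ c_w(x, y) dγ(x, y)`. -/
def planCost {d : ℕ} (γ : Measure (EuclideanSpace ℝ (Fin d) × EuclideanSpace ℝ (Fin d))) : ℝ :=
  ∫ p, repulsiveCost p.1 p.2 ∂γ

/-- The Monge functional `∫ c_w(x, T x) dμ(x)`. -/
def mapCost {d : ℕ} (μ : Measure (EuclideanSpace ℝ (Fin d)))
    (T : EuclideanSpace ℝ (Fin d) → EuclideanSpace ℝ (Fin d)) : ℝ :=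
  ∫ x, repulsiveCost x (T x) ∂μ

/-- `γ` minimises the Kantorovich functional among all transport plans. -/
def IsOptimalPlan {d : ℕ} (μ ν : Measure (EuclideanSpace ℝ (Fin d)))
    (γ : Measure (EuclideanSpace ℝ (Fin d) × EuclideanSpace ℝ (Fin d))) : Prop :=
  γ ∈ transportPlans μ ν ∧ ∀ γ' ∈ transportPlans μ ν, planCost γ ≤ planCost γ'

/-- `T` minimises the Monge functional among all transport maps. -/
def IsOptimalMap {d : ℕ} (μ ν : Measure (EuclideanSpace ℝ (Fin d)))
    (T : EuclideanSpace ℝ (Fin d) → EuclideanSpace ℝ (Fin d)) : Prop :=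
  T ∈ transportMaps μ ν ∧ ∀ S ∈ transportMaps μ ν, mapCost μ T ≤ mapCost μ S

/-- When the marginals have finite second moments the cost is integrable against every
transport plan, so the Bochner integral in `planCost` is a genuine one. -/
theorem integrable_repulsiveCost_of_mem_transportPlans {d : ℕ}
    {μ ν : Measure (EuclideanSpace ℝ (Fin d))}
    (hμ2 : Integrable (fun x => ‖x‖ ^ 2) μ) (hν2 : Integrable (fun y => ‖y‖ ^ 2) ν)
    {γ : Measure (EuclideanSpace ℝ (Fin d) × EuclideanSpace ℝ (Fin d))}
    (hγ : γ ∈ transportPlans μ ν) :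
    Integrable (fun p => repulsiveCost p.1 p.2) γ := by
  obtain ⟨-, rfl, rfl⟩ := hγ
  have h1 : Integrable (fun p => ‖p.1‖ ^ 2) γ := hμ2.comp_measurable measurable_fst
  have h2 : Integrable (fun p => ‖p.2‖ ^ 2) γ := hν2.comp_measurable measurable_snd
  refine ((h1.add h2).const_mul 2).mono' ?_ (Filter.Eventually.of_forall fun p => ?_)
  · unfold repulsiveCost
    exact Continuous.aestronglyMeasurable (by fun_prop)
  · have h := norm_sub_le p.1 p.2
    simp only [repulsiveCost, norm_neg, Real.norm_eq_abs, abs_pow, abs_norm, Pi.add_apply]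
    nlinarith [norm_nonneg (p.1 - p.2), sq_nonneg (‖p.1‖ - ‖p.2‖), norm_nonneg p.1,
      norm_nonneg p.2]

end

/-!
On transport plans with fixed marginals the cost `-|x - y|^2` differs from `2⟪x, y⟫` by terms whose
integral is the same for all plans, so the optimal plans are those that minimise `∫ ⟪x, y⟫ dγ`.
This is Brenier's theorem with the sign of `y` reversed: convex potentials become concave.

*Existence.* Up to the same constants the cost is also `|x + y|^2`, which is nonnegative and
continuous, so its integral is weakly lower semicontinuous; the set of plans is weakly compact by
Prokhorov's theorem (`exists_isOptimalPlan`).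

*Structure.* If cycles in the support of an optimal plan `γ` could be rearranged profitably, then
so could a set of positive measure of tuples of independent samples of `γ`, and performing the
rearrangement on a small part of `γ` would lower the cost
(`IsOptimalPlan.measure_pi_violating_eq_zero`). Hence the support is cyclically monotone, in the
orientation of concave functions. Rockafellar's construction gives a concave function `φ` for which
every `(x, y)` in the support is a pair of a point and a supergradient. It is finite on a convex
set `C` that contains the first coordinates. Since the boundary of `C` is Lebesgue null and a
concave function is locally Lipschitz, hence almost everywhere differentiable, on the interior of
`C`, absolute continuity of `μ` forces `y = ∇φ(x)` for `γ`-almost every `(x, y)`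
(`IsOptimalPlan.exists_eq_map_gradient`): the plan is the one induced by the map `∇φ`. If the
second coordinates are bounded, `φ` is an infimum of uniformly Lipschitz functions and is finite
everywhere.

*Uniqueness.* The midpoint of two optimal plans is optimal, so it is concentrated on the graph of a
single map; then both plans are concentrated on that graph and coincide (`IsOptimalPlan.eq`). No
dual problem is needed. The statements about maps follow, because each transport map induces a plan
of the same cost and the optimal plan is induced by a map.
-/

open Filter Topology Set
open scoped ENNReal NNReal RealInnerProductSpace

/-! ### Existence of an optimal plan -/

/-- The integral of a nonnegative continuous function, bounded or not, is lower semicontinuous for weak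
convergence. -/
theorem lowerSemicontinuous_lintegral_probabilityMeasure {X : Type*} [TopologicalSpace X]
    [MeasurableSpace X] [OpensMeasurableSpace X] {f : X → ℝ≥0} (hf : Continuous f) :
    LowerSemicontinuous fun γ : ProbabilityMeasure X => ∫⁻ x, f x ∂(γ : Measure X) := by
  -- `f` is the increasing limit of its truncations, which are bounded and continuous.
  let g : ℕ → BoundedContinuousFunction X ℝ≥0 := fun n =>
    BoundedContinuousFunction.mkOfBound ⟨fun x => min (f x) n, by fun_prop⟩ n fun x y => by
      rw [NNReal.dist_eq, abs_le]
      have h1 : ((min (f x) n : ℝ≥0) : ℝ) ≤ n := by exact_mod_cast min_le_right (f x) (n : ℝ≥0)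
      have h2 : ((min (f y) n : ℝ≥0) : ℝ) ≤ n := by exact_mod_cast min_le_right (f y) (n : ℝ≥0)
      constructor
      · exact (neg_le_neg h2).trans (by simp)
      · exact (sub_le_self _ (NNReal.coe_nonneg _)).trans h1
  have hg : ∀ n x, g n x = min (f x) n := fun n x => rfl
  have key : ∀ γ : ProbabilityMeasure X,
      ∫⁻ x, f x ∂(γ : Measure X) = ⨆ n, ∫⁻ x, g n x ∂(γ : Measure X) := by
    intro γ
    rw [← lintegral_iSup]
    · refine lintegral_congr fun x => le_antisymm ?_ (iSup_le fun n => ?_)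
      · obtain ⟨n, hn⟩ := exists_nat_ge (f x)
        exact le_iSup_of_le n (by rw [hg, min_eq_left hn])
      · rw [hg]
        exact_mod_cast min_le_left _ _
    · exact fun n => (ENNReal.continuous_coe.comp (g n).continuous).measurable
    · intro m n hmn x
      simp only [hg]
      exact_mod_cast min_le_min_left _ (Nat.cast_le.2 hmn)
  simp_rw [key]
  exact lowerSemicontinuous_iSup fun n =>
    (ProbabilityMeasure.continuous_iff_forall_continuous_lintegral.1 continuous_id
      (g n)).lowerSemicontinuous

variable {d : ℕ} {μ ν : Measure (EuclideanSpace ℝ (Fin d))}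

/-- Tightness of the marginals makes the set of transport plans relatively compact; it is closed
because taking marginals is continuous. -/
theorem isCompact_transportPlans [IsProbabilityMeasure μ] [IsProbabilityMeasure ν] :
    IsCompact {γ : ProbabilityMeasure (EuclideanSpace ℝ (Fin d) × EuclideanSpace ℝ (Fin d)) |
      (γ : Measure _) ∈ transportPlans μ ν} := by
  set S := {γ : ProbabilityMeasure (EuclideanSpace ℝ (Fin d) × EuclideanSpace ℝ (Fin d)) |
      (γ : Measure _) ∈ transportPlans μ ν} with hS
  have hclosed : IsClosed S := by
    have h : S = {γ | γ.map measurable_fst.aemeasurable = ⟨μ, inferInstance⟩} ∩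
        {γ | γ.map measurable_snd.aemeasurable = ⟨ν, inferInstance⟩} := by
      ext γ
      exact ⟨fun h => ⟨Subtype.ext h.2.1, Subtype.ext h.2.2⟩, fun h =>
        ⟨inferInstance, congrArg Subtype.val h.1, congrArg Subtype.val h.2⟩⟩
    rw [h]
    exact (isClosed_eq (ProbabilityMeasure.continuous_map continuous_fst) continuous_const).inter
      (isClosed_eq (ProbabilityMeasure.continuous_map continuous_snd) continuous_const)
  rw [← hclosed.closure_eq]
  refine isCompact_closure_of_isTightMeasureSet (IsTightMeasureSet.prodMk ?_ ?_)
  · refine (isTightMeasureSet_singleton (μ := μ)).subset ?_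
    rintro _ ⟨_, ⟨γ, hγ, rfl⟩, rfl⟩
    exact hγ.2.1
  · refine (isTightMeasureSet_singleton (μ := ν)).subset ?_
    rintro _ ⟨_, ⟨γ, hγ, rfl⟩, rfl⟩
    exact hγ.2.2

/-- Over plans with fixed marginals, `-|x - y|^2` and `|x + y|^2` differ by a constant. -/
theorem planCost_eq_integral_norm_add_sq (hμ2 : Integrable (fun x => ‖x‖ ^ 2) μ)
    (hν2 : Integrable (fun y => ‖y‖ ^ 2) ν)
    {γ : Measure (EuclideanSpace ℝ (Fin d) × EuclideanSpace ℝ (Fin d))}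
    (hγ : γ ∈ transportPlans μ ν) :
    Integrable (fun p => ‖p.1 + p.2‖ ^ 2) γ ∧
      planCost γ = ∫ p, ‖p.1 + p.2‖ ^ 2 ∂γ - 2 * (∫ x, ‖x‖ ^ 2 ∂μ + ∫ y, ‖y‖ ^ 2 ∂ν) := by
  have hc := integrable_repulsiveCost_of_mem_transportPlans hμ2 hν2 hγ
  obtain ⟨-, rfl, rfl⟩ := hγ
  have h1 : Integrable (fun p => ‖p.1‖ ^ 2) γ := hμ2.comp_measurable measurable_fst
  have h2 : Integrable (fun p => ‖p.2‖ ^ 2) γ := hν2.comp_measurable measurable_snd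
  have e : (fun p : EuclideanSpace ℝ (Fin d) × EuclideanSpace ℝ (Fin d) => ‖p.1 + p.2‖ ^ 2) =
      fun p => repulsiveCost p.1 p.2 + 2 * (‖p.1‖ ^ 2 + ‖p.2‖ ^ 2) := by
    funext p
    have := parallelogram_law_with_norm ℝ p.1 p.2
    simp only [repulsiveCost]
    linarith
  have h3 := (h1.add h2).const_mul 2
  rw [e]
  refine ⟨hc.add h3, ?_⟩
  rw [integral_add hc (by exact h3), integral_const_mul, integral_add h1 h2,
    integral_map measurable_fst.aemeasurable hμ2.1, integral_map measurable_snd.aemeasurable hν2.1]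
  simp only [planCost]
  ring

theorem exists_isOptimalPlan [IsProbabilityMeasure μ] [IsProbabilityMeasure ν]
    (hμ2 : Integrable (fun x => ‖x‖ ^ 2) μ) (hν2 : Integrable (fun y => ‖y‖ ^ 2) ν) :
    ∃ γ, IsOptimalPlan μ ν γ := by
  have hne : {γ : ProbabilityMeasure (EuclideanSpace ℝ (Fin d) × EuclideanSpace ℝ (Fin d)) |
      (γ : Measure _) ∈ transportPlans μ ν}.Nonempty :=
    ⟨⟨μ.prod ν, inferInstance⟩, show IsProbabilityMeasure (μ.prod ν) from inferInstance,
      by simp, by simp⟩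
  have hf : Continuous fun p : EuclideanSpace ℝ (Fin d) × EuclideanSpace ℝ (Fin d) =>
      ‖p.1 + p.2‖₊ ^ 2 := by fun_prop
  obtain ⟨γ, hγ, hmin⟩ := LowerSemicontinuousOn.exists_isMinOn hne isCompact_transportPlans
    ((lowerSemicontinuous_lintegral_probabilityMeasure hf).lowerSemicontinuousOn _)
  refine ⟨γ, hγ, fun γ' hγ' => ?_⟩
  obtain ⟨hi, he⟩ := planCost_eq_integral_norm_add_sq hμ2 hν2 hγ
  obtain ⟨hi', he'⟩ := planCost_eq_integral_norm_add_sq hμ2 hν2 hγ'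
  have hprob : IsProbabilityMeasure γ' := hγ'.1
  have hle := isMinOn_iff.1 hmin ⟨γ', hprob⟩ hγ'
  have hcoe : ∀ p : EuclideanSpace ℝ (Fin d) × EuclideanSpace ℝ (Fin d),
      ((‖p.1 + p.2‖₊ ^ 2 : ℝ≥0) : ℝ≥0∞) = ENNReal.ofReal (‖p.1 + p.2‖ ^ 2) := fun p => by
    rw [← ENNReal.ofReal_coe_nnreal]
    simp
  simp only [hcoe, ProbabilityMeasure.coe_mk] at hle
  rw [← ofReal_integral_eq_lintegral_ofReal hi (Eventually.of_forall fun p => by positivity),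
    ← ofReal_integral_eq_lintegral_ofReal hi' (Eventually.of_forall fun p => by positivity),
    ENNReal.ofReal_le_ofReal_iff (integral_nonneg fun p => by positivity)] at hle
  linarith

/-! ### Rockafellar's potential -/

section Rockafellar

variable {E : Type*} [NormedAddCommGroup E] [InnerProductSpace ℝ E]

/-- A set of pairs `(x, y)` is cyclically antitone (cyclically monotone in the orientation that
belongs to concave functions) if no cyclic shift of the first coordinates of finitely many of its
elements against the second ones decreases the sum of the inner products `⟪x, y⟫`. The index shift
`i + 1` in `Fin (n + 1)` is cyclic. -/
def CyclicallyAntitone (Γ : Set (E × E)) : Prop :=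
  ∀ (n : ℕ) (p : Fin (n + 1) → E × E), (∀ i, p i ∈ Γ) →
    ∑ i, ⟪(p i).1, (p i).2⟫ ≤ ∑ i, ⟪(p (i + 1)).1, (p i).2⟫

/-- The chains in `Γ` that start at the point `p₀`: `AntitoneChain Γ p₀ q a` means that some finite
sequence `p₀, p₁, …, pₙ = q` in `Γ` has `a = ∑ i < n, ⟪x_{i+1} - x_i, y_i⟫`. The
sequence is encoded by a function on `ℕ` whose values beyond `n` play no role. -/
def AntitoneChain (Γ : Set (E × E)) (p₀ q : E × E) (a : ℝ) : Prop :=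
  ∃ (n : ℕ) (p : ℕ → E × E), (∀ i, p i ∈ Γ) ∧ p 0 = p₀ ∧ p n = q ∧
    a = ∑ i ∈ Finset.range n, ⟪(p (i + 1)).1 - (p i).1, (p i).2⟫

variable {Γ : Set (E × E)} {p₀ q r : E × E} {a : ℝ}

theorem AntitoneChain.refl (h : p₀ ∈ Γ) : AntitoneChain Γ p₀ p₀ 0 :=
  ⟨0, fun _ => p₀, fun _ => h, rfl, rfl, by simp⟩

theorem AntitoneChain.mem (h : AntitoneChain Γ p₀ q a) : q ∈ Γ := by
  obtain ⟨n, p, hp, -, rfl, -⟩ := h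
  exact hp n

theorem AntitoneChain.snoc (h : AntitoneChain Γ p₀ q a) (hr : r ∈ Γ) :
    AntitoneChain Γ p₀ r (a + ⟪r.1 - q.1, q.2⟫) := by
  obtain ⟨n, p, hp, h0, rfl, rfl⟩ := h
  refine ⟨n + 1, fun i => if i ≤ n then p i else r, fun i => ?_, by simpa, by simp, ?_⟩
  · dsimp only
    split_ifs
    exacts [hp i, hr]
  · rw [Finset.sum_range_succ]
    congr 1
    · refine Finset.sum_congr rfl fun i hi => ?_
      have := Finset.mem_range.1 hi
      beta_reduce
      rw [if_pos (by omega), if_pos (by omega)]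
    · simp

theorem CyclicallyAntitone.mono {Γ' : Set (E × E)}
    (h : CyclicallyAntitone Γ) (hs : Γ' ⊆ Γ) : CyclicallyAntitone Γ' :=
  fun n p hp => h n p fun i => hs (hp i)

/-- Closing up a chain at its starting point gives a cycle. -/
theorem CyclicallyAntitone.nonneg_of_chain (hΓ : CyclicallyAntitone Γ)
    (h : AntitoneChain Γ p₀ q a) : 0 ≤ a + ⟪p₀.1 - q.1, q.2⟫ := by
  obtain ⟨n, p, hp, rfl, rfl, rfl⟩ := h
  have := hΓ n (fun i => p i) fun i => hp i
  rw [← sub_nonneg, ← Finset.sum_sub_distrib] at this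
  simp_rw [← inner_sub_left] at this
  rw [Fin.sum_univ_castSucc] at this
  rw [← Fin.sum_univ_eq_sum_range (fun i => ⟪(p (i + 1)).1 - (p i).1, (p i).2⟫)]
  simpa using this

/-- The set of values at `x` of the affine functions `x ↦ a + ⟪x - q.1, q.2⟫` attached to the chains
from `p₀`. -/
def chainValues (Γ : Set (E × E)) (p₀ : E × E) (x : E) : Set ℝ :=
  {s | ∃ q a, AntitoneChain Γ p₀ q a ∧ s = a + ⟪x - q.1, q.2⟫}

/-- Rockafellar's potential, the infimum of the affine functions attached to the chains from `p₀`.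
It is meaningful on `rockafellarDomain`, where the infimum is finite; elsewhere `sInf` takes
the value `0`. -/
noncomputable def rockafellarPotential (Γ : Set (E × E)) (p₀ : E × E) (x : E) : ℝ :=
  sInf (chainValues Γ p₀ x)

/-- The set of points where Rockafellar's potential is finite. -/
def rockafellarDomain (Γ : Set (E × E)) (p₀ : E × E) : Set E :=
  {x | BddBelow (chainValues Γ p₀ x)}

theorem chainValues_nonempty (h : p₀ ∈ Γ) (x : E) : (chainValues Γ p₀ x).Nonempty :=
  ⟨_, p₀, 0, .refl h, rfl⟩

theorem add_inner_mem_chainValues {x y z : E} (hx : (x, y) ∈ Γ) {s : ℝ}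
    (hs : s ∈ chainValues Γ p₀ x) : s + ⟪z - x, y⟫ ∈ chainValues Γ p₀ z := by
  obtain ⟨q, a, h, rfl⟩ := hs
  exact ⟨(x, y), _, h.snoc hx, rfl⟩

theorem convexComb_lowerBound {x z : E} {s t m m' : ℝ} (hs : 0 ≤ s) (ht : 0 ≤ t) (hst : s + t = 1)
    (hm : m ∈ lowerBounds (chainValues Γ p₀ x)) (hm' : m' ∈ lowerBounds (chainValues Γ p₀ z)) :
    s * m + t * m' ∈ lowerBounds (chainValues Γ p₀ (s • x + t • z)) := by
  rintro _ ⟨q, a, h, rfl⟩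
  have h1 := mul_le_mul_of_nonneg_left (hm ⟨q, a, h, rfl⟩) hs
  have h2 := mul_le_mul_of_nonneg_left (hm' ⟨q, a, h, rfl⟩) ht
  have e : a + ⟪s • x + t • z - q.1, q.2⟫ =
      s * (a + ⟪x - q.1, q.2⟫) + t * (a + ⟪z - q.1, q.2⟫) := by
    simp only [inner_sub_left, inner_add_left, real_inner_smul_left]
    linear_combination (⟪q.1, q.2⟫ - a) * hst
  linarith

theorem concaveOn_rockafellarPotential (h : p₀ ∈ Γ) :
    ConcaveOn ℝ (rockafellarDomain Γ p₀) (rockafellarPotential Γ p₀) := by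
  have lb : ∀ {x}, x ∈ rockafellarDomain Γ p₀ →
      rockafellarPotential Γ p₀ x ∈ lowerBounds (chainValues Γ p₀ x) :=
    fun hx _ hs => csInf_le hx hs
  refine ⟨fun x hx z hz s t hs ht hst => ?_, fun x hx z hz s t hs ht hst => ?_⟩
  · exact ⟨_, convexComb_lowerBound hs ht hst (lb hx) (lb hz)⟩
  · exact le_csInf (chainValues_nonempty h _) (convexComb_lowerBound hs ht hst (lb hx) (lb hz))

/-- A cyclically antitone set lies over the domain of its potential: lengthening a chain by `(x, y)`
and closing it up bounds its value at `x` from below. -/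
theorem CyclicallyAntitone.mem_rockafellarDomain (hΓ : CyclicallyAntitone Γ) {x y : E}
    (hx : (x, y) ∈ Γ) : x ∈ rockafellarDomain Γ p₀ := by
  refine ⟨-⟪p₀.1 - x, y⟫, ?_⟩
  rintro _ ⟨q, a, h, rfl⟩
  have := hΓ.nonneg_of_chain (h.snoc hx)
  dsimp only at this ⊢
  linarith

/-- If the second coordinates in `Γ` are bounded, Rockafellar's potential is an infimum of uniformly
Lipschitz functions, hence finite everywhere. -/
theorem CyclicallyAntitone.rockafellarDomain_eq_univ (hΓ : CyclicallyAntitone Γ) (h₀ : p₀ ∈ Γ)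
    {R : ℝ} (hR : ∀ p ∈ Γ, ‖p.2‖ ≤ R) : rockafellarDomain Γ p₀ = univ := by
  refine eq_univ_of_forall fun x => ?_
  obtain ⟨m, hm⟩ := hΓ.mem_rockafellarDomain (p₀ := p₀) h₀
  refine ⟨m - ‖x - p₀.1‖ * R, ?_⟩
  rintro _ ⟨q, a, h, rfl⟩
  have h1 := hm ⟨q, a, h, rfl⟩
  have h2 := neg_le_of_abs_le (abs_real_inner_le_norm (x - p₀.1) q.2)
  have h3 := mul_le_mul_of_nonneg_left (hR q h.mem) (norm_nonneg (x - p₀.1))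
  have e : ⟪x - q.1, q.2⟫ = ⟪p₀.1 - q.1, q.2⟫ + ⟪x - p₀.1, q.2⟫ := by
    rw [← inner_add_left]
    congr 1
    abel
  linarith

/-- The elements of `Γ` are pairs of a point and a supergradient of Rockafellar's potential. -/
theorem rockafellarPotential_le (h₀ : p₀ ∈ Γ) {x y z : E} (hx : (x, y) ∈ Γ)
    (hz : z ∈ rockafellarDomain Γ p₀) :
    rockafellarPotential Γ p₀ z ≤ rockafellarPotential Γ p₀ x + ⟪z - x, y⟫ := by
  rw [← sub_le_iff_le_add]
  refine le_csInf (chainValues_nonempty h₀ x) fun s hs => ?_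
  rw [sub_le_iff_le_add]
  exact csInf_le hz (add_inner_mem_chainValues hx hs)

/-- At a point of differentiability, the only supergradient is the gradient. -/
theorem HasGradientAt.eq_of_le_add_inner [CompleteSpace E] {φ : E → ℝ} {x y g : E}
    (hg : HasGradientAt φ g x) (h : ∀ᶠ z in 𝓝 x, φ z ≤ φ x + ⟪z - x, y⟫) : y = g := by
  have hmax : IsLocalMax (fun z => φ z - ⟪y, z⟫) x := by
    filter_upwards [h] with z hz
    rw [real_inner_comm, inner_sub_right] at hz
    linarith
  have hd : HasFDerivAt (fun z => φ z - ⟪y, z⟫)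
      (InnerProductSpace.toDual ℝ E g - InnerProductSpace.toDual ℝ E y) x :=
    hg.hasFDerivAt.sub (InnerProductSpace.toDual ℝ E y).hasFDerivAt
  have := sub_eq_zero.1 (hmax.hasFDerivAt_eq_zero hd)
  exact ((InnerProductSpace.toDual ℝ E).injective this).symm

end Rockafellar

/-! ### Almost everywhere differentiability of concave functions -/

theorem LocallyLipschitzOn.ae_differentiableAt {E : Type*} [NormedAddCommGroup E]
    [NormedSpace ℝ E] [FiniteDimensional ℝ E] [MeasurableSpace E] [BorelSpace E]
    (μ : Measure E) [μ.IsAddHaarMeasure] {f : E → ℝ} {D : Set E} (hD : IsOpen D)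
    (hf : LocallyLipschitzOn D f) : ∀ᵐ x ∂μ, x ∈ D → DifferentiableAt ℝ f x := by
  have hloc : ∀ x ∈ D, ∃ t ∈ 𝓝[D] x, ∀ᵐ z ∂μ, z ∈ t → DifferentiableAt ℝ f z := by
    intro x hx
    obtain ⟨K, t, ht, hK⟩ := hf hx
    rw [hD.nhdsWithin_eq hx] at ht ⊢
    refine ⟨interior t, interior_mem_nhds.2 ht, ?_⟩
    filter_upwards [(hK.mono interior_subset).ae_differentiableWithinAt_of_mem (μ := μ)]
      with z hz hzt
    exact (hz hzt).differentiableAt (isOpen_interior.mem_nhds hzt)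
  choose! t ht hdiff using hloc
  obtain ⟨s, hs, hcount, hcover⟩ := TopologicalSpace.countable_cover_nhdsWithin ht
  filter_upwards [(ae_ball_iff hcount).2 fun x hx => hdiff x (hs hx)] with z hz hzD
  obtain ⟨x, hx, hzx⟩ := mem_iUnion₂.1 (hcover hzD)
  exact hz x hx hzx

theorem measurable_gradient {E : Type*} [NormedAddCommGroup E] [InnerProductSpace ℝ E]
    [CompleteSpace E] [MeasurableSpace E] [BorelSpace E] (f : E → ℝ) :
    Measurable (gradient f) :=
  (InnerProductSpace.toDual ℝ E).symm.continuous.measurable.comp (measurable_fderiv ℝ f)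

/-! ### Optimal plans have cyclically monotone support -/

/-- Along a cycle, the squared norms in the cost cancel. -/
theorem sum_repulsiveCost_sub_sum_shift {n : ℕ}
    (q : Fin (n + 1) → EuclideanSpace ℝ (Fin d) × EuclideanSpace ℝ (Fin d)) :
    ∑ i, repulsiveCost (q i).1 (q i).2 - ∑ i, repulsiveCost (q (i + 1)).1 (q i).2 =
      2 * (∑ i, ⟪(q i).1, (q i).2⟫ - ∑ i, ⟪(q (i + 1)).1, (q i).2⟫) := by
  have h : ∑ i, ‖(q (i + 1)).1‖ ^ 2 = ∑ i, ‖(q i).1‖ ^ 2 :=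
    Equiv.sum_comp (Equiv.addRight (1 : Fin (n + 1))) fun i => ‖(q i).1‖ ^ 2
  simp only [repulsiveCost, norm_sub_sq_real, Finset.sum_neg_distrib, Finset.sum_add_distrib,
    Finset.sum_sub_distrib, ← Finset.mul_sum]
  linarith

theorem map_const_smul_sum {X Y ι : Type*} [MeasurableSpace X] [MeasurableSpace Y]
    {f : X → Y} (hf : Measurable f) (k : ℝ≥0∞) (s : Finset ι) (m : ι → Measure X) :
    (k • ∑ i ∈ s, m i).map f = k • ∑ i ∈ s, (m i).map f := by
  rw [Measure.map_smul, Measure.map_finset_sum hf.aemeasurable]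

theorem integral_const_smul_sum_map {X Y ι : Type*} [MeasurableSpace X] [MeasurableSpace Y]
    {η : Measure X} [Fintype ι] {k : ℝ≥0∞} (hk : k ≠ 0) (hk' : k ≠ ∞) {f : ι → X → Y}
    (hf : ∀ i, Measurable (f i)) {c : Y → ℝ}
    (hc : Integrable c (k • ∑ i, η.map (f i))) :
    Integrable (fun x => ∑ i, c (f i x)) η ∧
    ∫ y, c y ∂(k • ∑ i, η.map (f i)) = k.toReal * ∫ x, ∑ i, c (f i x) ∂η := by
  rw [integrable_smul_measure hk hk', integrable_finsetSum_measure] at hc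
  have hi : ∀ i ∈ Finset.univ, Integrable (fun x => c (f i x)) η := fun i hmem =>
    (hc i hmem).comp_measurable (hf i)
  refine ⟨integrable_finsetSum _ hi, ?_⟩
  rw [integral_smul_measure, integral_finsetSum_measure hc, integral_finsetSum _ hi, smul_eq_mul]
  congr 1
  exact Finset.sum_congr rfl fun i hmem => integral_map (hf i).aemeasurable (hc i hmem).1

/-- Almost no cycle of independent samples of an optimal plan violates cyclic monotonicity.
Let `η` be the restriction of the product measure to the violating tuples. Its marginals are at most
`γ`, so the average of the marginals may be taken out of `γ` and replaced by the average of the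
joint laws of `(x_{i+1}, y_i)`, which keeps both marginals of the plan and lowers the cost
strictly unless `η = 0`. -/
theorem IsOptimalPlan.measure_pi_violating_eq_zero
    (hμ2 : Integrable (fun x => ‖x‖ ^ 2) μ) (hν2 : Integrable (fun y => ‖y‖ ^ 2) ν)
    {γ : Measure (EuclideanSpace ℝ (Fin d) × EuclideanSpace ℝ (Fin d))}
    (hγ : IsOptimalPlan μ ν γ) (n : ℕ) :
    (Measure.pi fun _ : Fin (n + 1) => γ)
      {q | ∑ i, ⟪(q (i + 1)).1, (q i).2⟫ < ∑ i, ⟪(q i).1, (q i).2⟫} = 0 := by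
  obtain ⟨⟨hprob, hfst, hsnd⟩, hopt⟩ := hγ
  set N := {q : Fin (n + 1) → EuclideanSpace ℝ (Fin d) × EuclideanSpace ℝ (Fin d) |
    ∑ i, ⟪(q (i + 1)).1, (q i).2⟫ < ∑ i, ⟪(q i).1, (q i).2⟫}
  have hNo : IsOpen N := isOpen_lt (by fun_prop) (by fun_prop)
  set P := Measure.pi fun _ : Fin (n + 1) => γ
  set η := P.restrict N
  set k : ℝ≥0∞ := ((n + 1 : ℕ) : ℝ≥0∞)⁻¹ with hk
  have hk0 : k ≠ 0 := ENNReal.inv_ne_zero.2 (ENNReal.natCast_ne_top _)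
  have hkt : k ≠ ∞ := ENNReal.inv_ne_top.2 (by positivity)
  set e : Fin (n + 1) → (Fin (n + 1) → EuclideanSpace ℝ (Fin d) × EuclideanSpace ℝ (Fin d)) →
    EuclideanSpace ℝ (Fin d) × EuclideanSpace ℝ (Fin d) := fun i q => q i with he
  set e' : Fin (n + 1) → (Fin (n + 1) → EuclideanSpace ℝ (Fin d) × EuclideanSpace ℝ (Fin d)) →
    EuclideanSpace ℝ (Fin d) × EuclideanSpace ℝ (Fin d) := fun i q => ((q (i + 1)).1, (q i).2)
    with he'
  have hem : ∀ i, Measurable (e i) := fun i => measurable_pi_apply i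
  have hem' : ∀ i, Measurable (e' i) := fun i => by fun_prop
  set σ := k • ∑ i, η.map (e i) with hσ
  set σ' := k • ∑ i, η.map (e' i) with hσ'
  have hσγ : σ ≤ γ := by
    have h1 : ∀ i, η.map (e i) ≤ γ := fun i =>
      (Measure.map_mono Measure.restrict_le_self (hem i)).trans
        (measurePreserving_eval (fun _ : Fin (n + 1) => γ) i).map_eq.le
    intro s
    simp only [hσ, Measure.smul_apply, Measure.finsetSum_apply, smul_eq_mul]
    calc k * ∑ i, η.map (e i) s ≤ k * ∑ _i : Fin (n + 1), γ s := by
          gcongr with i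
          exact h1 i
      _ = γ s := by
          rw [Finset.sum_const, Finset.card_univ, Fintype.card_fin, nsmul_eq_mul, ← mul_assoc, hk,
            ENNReal.inv_mul_cancel (by positivity) (ENNReal.natCast_ne_top _), one_mul]
  have : IsFiniteMeasure σ := isFiniteMeasure_of_le γ hσγ
  have hsub : γ - σ + σ = γ := Measure.sub_add_cancel_of_le hσγ
  have hmfst : σ'.map Prod.fst = σ.map Prod.fst := by
    rw [hσ, hσ', map_const_smul_sum measurable_fst,
      map_const_smul_sum measurable_fst]
    congr 1
    simp_rw [Measure.map_map measurable_fst (hem _), Measure.map_map measurable_fst (hem' _)]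
    exact Equiv.sum_comp (Equiv.addRight (1 : Fin (n + 1))) fun i => η.map (Prod.fst ∘ e i)
  have hmsnd : σ'.map Prod.snd = σ.map Prod.snd := by
    rw [hσ, hσ', map_const_smul_sum measurable_snd,
      map_const_smul_sum measurable_snd]
    simp_rw [Measure.map_map measurable_snd (hem _), Measure.map_map measurable_snd (hem' _)]
    rfl
  have hγ' : γ - σ + σ' ∈ transportPlans μ ν := by
    have h1 : (γ - σ + σ').map Prod.fst = μ := by
      rw [Measure.map_add _ _ measurable_fst, hmfst, ← Measure.map_add _ _ measurable_fst, hsub,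
        hfst]
    have h2 : (γ - σ + σ').map Prod.snd = ν := by
      rw [Measure.map_add _ _ measurable_snd, hmsnd, ← Measure.map_add _ _ measurable_snd, hsub,
        hsnd]
    refine ⟨⟨?_⟩, h1, h2⟩
    rw [← preimage_univ (f := Prod.fst), ← Measure.map_apply measurable_fst .univ, h1, ← hfst,
      Measure.map_apply measurable_fst .univ, preimage_univ, measure_univ]
  have hi := integrable_repulsiveCost_of_mem_transportPlans hμ2 hν2 ⟨hprob, hfst, hsnd⟩
  have hi' := integrable_repulsiveCost_of_mem_transportPlans hμ2 hν2 hγ'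
  have hle := hopt _ hγ'
  nth_rewrite 1 [← hsub] at hle
  rw [← hsub] at hi
  obtain ⟨hiρ, hiσ⟩ := integrable_add_measure.1 hi
  obtain ⟨-, hiσ'⟩ := integrable_add_measure.1 hi'
  obtain ⟨hg, hgσ⟩ := integral_const_smul_sum_map hk0 hkt hem hiσ
  obtain ⟨hg', hgσ'⟩ := integral_const_smul_sum_map hk0 hkt hem' hiσ'
  simp only [planCost] at hle
  rw [integral_add_measure hiρ hiσ, integral_add_measure hiρ hiσ', add_le_add_iff_left,
    hgσ, hgσ'] at hle
  have hle' := le_of_mul_le_mul_left hle (ENNReal.toReal_pos hk0 hkt)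
  by_contra hne
  have hpos : ∀ q ∈ N, 0 < ∑ i, repulsiveCost (e i q).1 (e i q).2 -
      ∑ i, repulsiveCost (e' i q).1 (e' i q).2 := fun q hq => by
    simp only [he, he', sum_repulsiveCost_sub_sum_shift]
    have : ∑ i, ⟪(q (i + 1)).1, (q i).2⟫ < ∑ i, ⟪(q i).1, (q i).2⟫ := hq
    linarith
  have hlt : 0 < ∫ q in N, (∑ i, repulsiveCost (e i q).1 (e i q).2 -
      ∑ i, repulsiveCost (e' i q).1 (e' i q).2) ∂P := by
    refine (setIntegral_pos_iff_support_of_nonneg_ae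
      ((ae_restrict_mem hNo.measurableSet).mono fun q hq => (hpos q hq).le) (hg.sub hg')).2 ?_
    exact (pos_iff_ne_zero.2 hne).trans_le
      (measure_mono fun q hq => ⟨Function.mem_support.2 (hpos q hq).ne', hq⟩)
  rw [integral_sub hg hg'] at hlt
  linarith

theorem IsOptimalPlan.cyclicallyAntitone_support
    (hμ2 : Integrable (fun x => ‖x‖ ^ 2) μ) (hν2 : Integrable (fun y => ‖y‖ ^ 2) ν)
    {γ : Measure (EuclideanSpace ℝ (Fin d) × EuclideanSpace ℝ (Fin d))}
    (hγ : IsOptimalPlan μ ν γ) : CyclicallyAntitone γ.support := by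
  intro n p hp
  by_contra! hlt
  have hprob : IsProbabilityMeasure γ := hγ.1.1
  -- A violating tuple in the support has a product neighbourhood of violating tuples.
  have hNo : IsOpen {q : Fin (n + 1) → EuclideanSpace ℝ (Fin d) × EuclideanSpace ℝ (Fin d) |
      ∑ i, ⟪(q (i + 1)).1, (q i).2⟫ < ∑ i, ⟪(q i).1, (q i).2⟫} :=
    isOpen_lt (by fun_prop) (by fun_prop)
  obtain ⟨U, hU, hUN⟩ := isOpen_pi_iff'.1 hNo p hlt
  have h0 := measure_mono_null hUN (hγ.measure_pi_violating_eq_zero hμ2 hν2 n)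
  rw [Measure.pi_pi, Finset.prod_eq_zero_iff] at h0
  obtain ⟨i, -, hi⟩ := h0
  exact ((Measure.mem_support_iff_forall _).1 (hp i) _ ((hU i).1.mem_nhds (hU i).2)).ne' hi

/-! ### Plans on the superdifferential of a concave function -/

/-- A plan that has an absolutely continuous first marginal and is concentrated on a cyclically
antitone set is carried by the graph of the gradient of Rockafellar's potential. -/
theorem CyclicallyAntitone.exists_plan_eq_map_gradient (hμ : μ ≪ volume)
    {γ : Measure (EuclideanSpace ℝ (Fin d) × EuclideanSpace ℝ (Fin d))}
    (hγ : γ ∈ transportPlans μ ν)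
    {Γ : Set (EuclideanSpace ℝ (Fin d) × EuclideanSpace ℝ (Fin d))} (hΓ : CyclicallyAntitone Γ)
    (hΓγ : ∀ᵐ p ∂γ, p ∈ Γ) :
    ∃ (D : Set (EuclideanSpace ℝ (Fin d))) (φ : EuclideanSpace ℝ (Fin d) → ℝ),
      IsOpen D ∧ Convex ℝ D ∧ μ Dᶜ = 0 ∧ ConcaveOn ℝ D φ ∧
      (∀ᵐ x ∂μ, HasGradientAt φ (gradient φ x) x) ∧
      ((∃ R : ℝ, ∀ p ∈ Γ, ‖p.2‖ ≤ R) → D = univ) ∧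
      γ = μ.map fun x => (x, gradient φ x) := by
  obtain ⟨hprob, hfst, -⟩ := hγ
  obtain ⟨p₀, hp₀⟩ := hΓγ.exists
  set φ := rockafellarPotential Γ p₀
  set D := interior (rockafellarDomain Γ p₀) with hD
  have hconc := concaveOn_rockafellarPotential hp₀
  have hDo : IsOpen D := isOpen_interior
  have hconcD : ConcaveOn ℝ D φ := hconc.subset interior_subset hconc.1.interior
  -- `Γ` lies over the domain of the potential, and the boundary of a convex set is negligible.
  have hfr : ∀ᵐ x ∂μ, x ∉ frontier (rockafellarDomain Γ p₀) :=
    hμ.ae_le (measure_eq_zero_iff_ae_notMem.1 (hconc.1.addHaar_frontier volume))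
  have hfrγ : ∀ᵐ p ∂γ, p.1 ∉ frontier (rockafellarDomain Γ p₀) :=
    ae_of_ae_map measurable_fst.aemeasurable (hfst.symm ▸ hfr)
  have hDγ : ∀ᵐ p ∂γ, p.1 ∈ D := by
    filter_upwards [hΓγ, hfrγ] with p hp hpf
    by_contra hpD
    exact hpf ⟨subset_closure (hΓ.mem_rockafellarDomain (y := p.2) hp), hpD⟩
  have hDμ : ∀ᵐ x ∂μ, x ∈ D := by
    rw [← hfst]
    exact (ae_map_iff measurable_fst.aemeasurable hDo.measurableSet).2 hDγ
  have hgrad : ∀ᵐ x ∂μ, HasGradientAt φ (gradient φ x) x := by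
    filter_upwards [hDμ, hμ.ae_le ((hconcD.locallyLipschitzOn hDo).ae_differentiableAt volume hDo)]
      with x hx hdiff
    exact (hdiff hx).hasGradientAt
  have hgradγ : ∀ᵐ p ∂γ, HasGradientAt φ (gradient φ p.1) p.1 :=
    ae_of_ae_map measurable_fst.aemeasurable (hfst.symm ▸ hgrad)
  refine ⟨D, φ, hDo, hconc.1.interior, hDμ, hconcD, hgrad, ?_, ?_⟩
  · rintro ⟨R, hR⟩
    rw [hD, hΓ.rockafellarDomain_eq_univ hp₀ hR, interior_univ]
  · have hgraph : (id : EuclideanSpace ℝ (Fin d) × EuclideanSpace ℝ (Fin d) → _) =ᵐ[γ]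
        fun p => (p.1, gradient φ p.1) := by
      filter_upwards [hΓγ, hDγ, hgradγ] with p hp hpD hpg
      refine Prod.ext rfl (hpg.eq_of_le_add_inner ?_)
      filter_upwards [hDo.mem_nhds hpD] with z hz
      exact rockafellarPotential_le hp₀ hp (interior_subset hz)
    calc γ = γ.map id := Measure.map_id.symm
      _ = γ.map fun p => (p.1, gradient φ p.1) := Measure.map_congr hgraph
      _ = (γ.map Prod.fst).map fun x => (x, gradient φ x) :=
        (Measure.map_map (measurable_id.prodMk (measurable_gradient φ)) measurable_fst).symm
      _ = μ.map fun x => (x, gradient φ x) := by rw [hfst]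

/-- An optimal plan is induced by the gradient of a concave function, which is finite everywhere if
the second marginal has bounded support. -/
theorem IsOptimalPlan.exists_eq_map_gradient (hμ : μ ≪ volume)
    (hμ2 : Integrable (fun x => ‖x‖ ^ 2) μ) (hν2 : Integrable (fun y => ‖y‖ ^ 2) ν)
    {γ : Measure (EuclideanSpace ℝ (Fin d) × EuclideanSpace ℝ (Fin d))}
    (hγ : IsOptimalPlan μ ν γ) :
    ∃ (D : Set (EuclideanSpace ℝ (Fin d))) (φ : EuclideanSpace ℝ (Fin d) → ℝ),
      IsOpen D ∧ Convex ℝ D ∧ μ Dᶜ = 0 ∧ ConcaveOn ℝ D φ ∧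
      (∀ᵐ x ∂μ, HasGradientAt φ (gradient φ x) x) ∧
      ((∃ R : ℝ, ∀ᵐ y ∂ν, ‖y‖ ≤ R) → D = univ) ∧
      γ = μ.map fun x => (x, gradient φ x) := by
  have hsupp : ∀ᵐ p ∂γ, p ∈ γ.support := Measure.support_mem_ae
  have hanti := hγ.cyclicallyAntitone_support hμ2 hν2
  by_cases hb : ∃ R : ℝ, ∀ᵐ y ∂ν, ‖y‖ ≤ R
  · -- Discarding the part of the support over the null set `‖y‖ > R` makes the potential finite.
    obtain ⟨R, hR⟩ := hb
    have hRγ : ∀ᵐ p ∂γ, ‖p.2‖ ≤ R :=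
      ae_of_ae_map measurable_snd.aemeasurable (hγ.1.2.2.symm ▸ hR)
    obtain ⟨D, φ, h1, h2, h3, h4, h5, h6, h7⟩ :=
      (hanti.mono (sep_subset _ fun p => ‖p.2‖ ≤ R)).exists_plan_eq_map_gradient hμ hγ.1
        (hsupp.and hRγ)
    exact ⟨D, φ, h1, h2, h3, h4, h5, fun _ => h6 ⟨R, fun p hp => hp.2⟩, h7⟩
  · obtain ⟨D, φ, h1, h2, h3, h4, h5, -, h7⟩ :=
      hanti.exists_plan_eq_map_gradient hμ hγ.1 hsupp
    exact ⟨D, φ, h1, h2, h3, h4, h5, fun h => absurd h hb, h7⟩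

/-! ### Uniqueness and the Monge problem -/

theorem graph_ae_eq_of_map_eq {X Y : Type*} [MeasurableSpace X] [MeasurableSpace Y]
    [MeasurableEq Y] {m : Measure X} {S T : X → Y} (hS : Measurable S)
    (hT : Measurable T) (h : m.map (fun x => (x, S x)) = m.map fun x => (x, T x)) : S =ᵐ[m] T := by
  have hmeas : MeasurableSet {p : X × Y | p.2 = T p.1} :=
    measurableSet_eq_fun measurable_snd (hT.comp measurable_fst)
  have h1 : ∀ᵐ p ∂m.map (fun x => (x, T x)), p.2 = T p.1 :=
    (ae_map_iff (measurable_id.prodMk hT).aemeasurable hmeas).2 (ae_of_all _ fun _ => rfl)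
  rw [← h] at h1
  exact ae_of_ae_map (measurable_id.prodMk hS).aemeasurable h1

/-- The cost of plans is affine, so the midpoint of two optimal plans is optimal. -/
theorem IsOptimalPlan.midpoint
    (hμ2 : Integrable (fun x => ‖x‖ ^ 2) μ) (hν2 : Integrable (fun y => ‖y‖ ^ 2) ν)
    {γ γ' : Measure (EuclideanSpace ℝ (Fin d) × EuclideanSpace ℝ (Fin d))}
    (hγ : IsOptimalPlan μ ν γ) (hγ' : IsOptimalPlan μ ν γ') :
    IsOptimalPlan μ ν ((2⁻¹ : ℝ≥0∞) • (γ + γ')) := by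
  have hi := integrable_repulsiveCost_of_mem_transportPlans hμ2 hν2 hγ.1
  have hi' := integrable_repulsiveCost_of_mem_transportPlans hμ2 hν2 hγ'.1
  have hp := hγ.1.1
  have hp' := hγ'.1.1
  have half : ∀ {X : Type _} [MeasurableSpace X] (m : Measure X), (2⁻¹ : ℝ≥0∞) • (m + m) = m := by
    intro X _ m
    rw [← two_smul ℝ≥0∞ m, smul_smul, ENNReal.inv_mul_cancel (by norm_num) (by norm_num), one_smul]
  refine ⟨⟨⟨?_⟩, ?_, ?_⟩, fun ρ hρ => ?_⟩
  · rw [Measure.smul_apply, Measure.add_apply, measure_univ, measure_univ, smul_eq_mul,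
      one_add_one_eq_two, ENNReal.inv_mul_cancel (by norm_num) (by norm_num)]
  · rw [Measure.map_smul, Measure.map_add _ _ measurable_fst, hγ.1.2.1, hγ'.1.2.1, half]
  · rw [Measure.map_smul, Measure.map_add _ _ measurable_snd, hγ.1.2.2, hγ'.1.2.2, half]
  · have h1 := hγ.2 ρ hρ
    have h2 := hγ'.2 ρ hρ
    have h3 : planCost ((2⁻¹ : ℝ≥0∞) • (γ + γ')) = 2⁻¹ * (planCost γ + planCost γ') := by
      simp only [planCost]
      rw [integral_smul_measure, integral_add_measure hi hi']
      simp
    linarith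

theorem IsOptimalPlan.eq (hμ : μ ≪ volume)
    (hμ2 : Integrable (fun x => ‖x‖ ^ 2) μ) (hν2 : Integrable (fun y => ‖y‖ ^ 2) ν)
    {γ γ' : Measure (EuclideanSpace ℝ (Fin d) × EuclideanSpace ℝ (Fin d))}
    (hγ : IsOptimalPlan μ ν γ) (hγ' : IsOptimalPlan μ ν γ') : γ = γ' := by
  obtain ⟨-, φ, -, -, -, -, -, -, hmid⟩ :=
    (hγ.midpoint hμ2 hν2 hγ').exists_eq_map_gradient hμ hμ2 hν2
  obtain ⟨-, ψ, -, -, -, -, -, -, h⟩ := hγ.exists_eq_map_gradient hμ hμ2 hν2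
  obtain ⟨-, ψ', -, -, -, -, -, -, h'⟩ := hγ'.exists_eq_map_gradient hμ hμ2 hν2
  have hmeas : ∀ f : EuclideanSpace ℝ (Fin d) → ℝ, Measurable fun x => (x, gradient f x) :=
    fun f => measurable_id.prodMk (measurable_gradient f)
  have hset : MeasurableSet
      {p : EuclideanSpace ℝ (Fin d) × EuclideanSpace ℝ (Fin d) | p.2 = gradient φ p.1} :=
    measurableSet_eq_fun measurable_snd ((measurable_gradient φ).comp measurable_fst)
  -- The midpoint lives on the graph of one map, hence so do `γ` and `γ'`.
  have hae : ∀ᵐ p ∂((2⁻¹ : ℝ≥0∞) • (γ + γ')), p.2 = gradient φ p.1 := by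
    rw [hmid]
    exact (ae_map_iff (hmeas φ).aemeasurable hset).2 (ae_of_all _ fun _ => rfl)
  rw [Measure.ae_ennreal_smul_measure_iff (by simp), ae_add_measure_iff] at hae
  have h1 : ∀ᵐ x ∂μ, gradient ψ x = gradient φ x :=
    ae_of_ae_map (hmeas ψ).aemeasurable (h ▸ hae.1)
  have h2 : ∀ᵐ x ∂μ, gradient ψ' x = gradient φ x :=
    ae_of_ae_map (hmeas ψ').aemeasurable (h' ▸ hae.2)
  rw [h, h']
  refine Measure.map_congr ?_
  filter_upwards [h1, h2] with x hx hx'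
  rw [hx, hx']

theorem map_graph_mem_transportPlans [IsProbabilityMeasure μ]
    {S : EuclideanSpace ℝ (Fin d) → EuclideanSpace ℝ (Fin d)} (hS : S ∈ transportMaps μ ν) :
    μ.map (fun x => (x, S x)) ∈ transportPlans μ ν := by
  have hm : Measurable fun x => (x, S x) := measurable_id.prodMk hS.1
  refine ⟨Measure.isProbabilityMeasure_map hm.aemeasurable, ?_, ?_⟩
  · rw [Measure.map_map measurable_fst hm]
    exact Measure.map_id
  · rw [Measure.map_map measurable_snd hm]
    exact hS.2

theorem planCost_map_graph {S : EuclideanSpace ℝ (Fin d) → EuclideanSpace ℝ (Fin d)}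
    (hS : Measurable S) : planCost (μ.map fun x => (x, S x)) = mapCost μ S := by
  refine integral_map (measurable_id.prodMk hS).aemeasurable ?_
  unfold repulsiveCost
  exact Continuous.aestronglyMeasurable (by fun_prop)

theorem mainTheorem6 (d : ℕ) (μ ν : Measure (EuclideanSpace ℝ (Fin d)))
    [IsProbabilityMeasure μ] [IsProbabilityMeasure ν]
    (hμ : μ ≪ volume) (hν : ∀ y, ν {y} = 0)
    (hμ2 : Integrable (fun x => ‖x‖ ^ 2) μ) (hν2 : Integrable (fun y => ‖y‖ ^ 2) ν) :
    ∃ T : EuclideanSpace ℝ (Fin d) → EuclideanSpace ℝ (Fin d),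
      -- `T` is an optimal transport map, and the only one up to `μ`-null sets
      IsOptimalMap μ ν T ∧
      (∀ S, IsOptimalMap μ ν S → S =ᵐ[μ] T) ∧
      -- the Kantorovich minimum is attained and equals the Monge infimum
      (∃ m : ℝ, IsLeast (planCost '' transportPlans μ ν) m ∧
        IsGLB (mapCost μ '' transportMaps μ ν) m) ∧
      -- `T` is the gradient of a concave function
      (∃ (D : Set (EuclideanSpace ℝ (Fin d))) (φ : EuclideanSpace ℝ (Fin d) → ℝ),
        IsOpen D ∧ Convex ℝ D ∧ μ Dᶜ = 0 ∧ ConcaveOn ℝ D φ ∧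
        (∀ᵐ x ∂μ, HasGradientAt φ (T x) x) ∧
        ((∃ R : ℝ, ∀ᵐ y ∂ν, ‖y‖ ≤ R) → D = Set.univ)) ∧
      -- the plan induced by `T` is the unique optimal plan
      (∀ γ, IsOptimalPlan μ ν γ ↔ γ = μ.map (fun x => (x, T x))) := by
  obtain ⟨γ, hγ⟩ := exists_isOptimalPlan hμ2 hν2
  obtain ⟨D, φ, hDo, hDc, hDμ, hconc, hgrad, hbdd, hmap⟩ :=
    hγ.exists_eq_map_gradient hμ hμ2 hν2
  have hTm : Measurable (gradient φ) := measurable_gradient φ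
  have hT : gradient φ ∈ transportMaps μ ν := by
    refine ⟨hTm, ?_⟩
    rw [← hγ.1.2.2, hmap, Measure.map_map measurable_snd (measurable_id'.prodMk hTm)]
    rfl
  have hcost : planCost γ = mapCost μ (gradient φ) := by
    rw [hmap, planCost_map_graph hTm]
  have hle : ∀ S ∈ transportMaps μ ν, mapCost μ (gradient φ) ≤ mapCost μ S := fun S hS => by
    rw [← hcost, ← planCost_map_graph hS.1]
    exact hγ.2 _ (map_graph_mem_transportPlans hS)
  refine ⟨gradient φ, ⟨hT, hle⟩, fun S hS => ?_, ⟨planCost γ, ⟨⟨γ, hγ.1, rfl⟩, ?_⟩, ?_⟩,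
    ⟨D, φ, hDo, hDc, hDμ, hconc, hgrad, hbdd⟩, fun ρ => ⟨fun hρ => ?_, fun hρ => ?_⟩⟩
  · have hopt : IsOptimalPlan μ ν (μ.map fun x => (x, S x)) := by
      refine ⟨map_graph_mem_transportPlans hS.1, fun ρ hρ => ?_⟩
      rw [planCost_map_graph hS.1.1]
      exact ((hS.2 _ hT).trans hcost.ge).trans (hγ.2 ρ hρ)
    exact graph_ae_eq_of_map_eq hS.1.1 hTm ((hopt.eq hμ hμ2 hν2 hγ).trans hmap)
  · rintro _ ⟨ρ, hρ, rfl⟩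
    exact hγ.2 ρ hρ
  · refine IsLeast.isGLB ⟨⟨gradient φ, hT, hcost.symm⟩, ?_⟩
    rintro _ ⟨S, hS, rfl⟩
    exact hcost.trans_le (hle S hS)
  · exact (hρ.eq hμ hμ2 hν2 hγ).trans hmap
  · rw [hρ, ← hmap]
    exact hγ
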